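/- Let $I,B\ge 1$ be integers, $X=[0,1]^I$, and let $\mu$ be a probability measure on $X$ with a density $\rho$ that is continuously differentiable on $X$ and satisfies $c\le\rho\le C$ on $X$ for some constants $0<c<C$. Let $\eta$ be the law of $\xi^{B-1}$, where $\xi$ is uniform on $[0,1]$. For measures $\nu',\nu$ on $[0,\infty)$ write $\nu'\preceq\nu$ if $\int\varphi\,d\nu'\le\int\varphi\,d\nu$ for every convex non-decreasing $\varphi:\mathbb{R}\to\mathbb{R}$. Let $\mathcal U$ be the set of convex, coordinatewise non-decreasing functions $u:X\to[0,\infty)$ with $u(0)=0$ and $|u(x)-u(y)|\le\sum_i|x_i-y_i|$ for all $x,y\in X$. The multi-bidder Rochet–Choné problem is to maximize $$B\int_X\big(\langle x,\nabla u(x)\rangle-u(x)\big)\,d\mu(x)$$ over all $u\in\mathcal U$ such that for every $i=1,\dots,I$ the law of $\partial u/\partial x_i$ under $\mu$ is $\preceq\eta$; call such $u$ feasible. For $n\ge1$, divide $X$ into $n^I$ equal closed cubes $\sigma^{(n)}_j$ of edge length $1/n$ with centers $\theta^{(n)}_j$, $1\le j\le n^I$, and put $\mu^{(n)}_j=n^{-I}\min_{\sigma^{(n)}_j}\rho$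 and $\mu^{(n)}_0=1-\sum_{j\ge 1}\mu^{(n)}_j$. The program $\mathcal D_n$ is to maximize $\sum_j\mu^{(n)}_j\big(\langle\theta^{(n)}_j,p_j\rangle-u_j\big)$ over $u_j\in\mathbb{R}$ and $p_j=(p_{j,k})_k\in\mathbb{R}^I$ subject to $u_j\ge0$; $0\le p_{j,k}\le1$; $u_i-u_j\ge\langle\theta^{(n)}_i-\theta^{(n)}_j,p_j\rangle$ for all $i,j$; and $\mu^{(n)}_0\delta_0+\sum_j\mu^{(n)}_j\delta_{p_{j,k}}\preceq\eta$ for all $k=1,\dots,I$. For every $n\ge1$ let $(\overline u^{(n)}_j,\overline p^{(n)}_j)_j$ be an optimal solution of $\mathcal D_n$, and define the convex function $$\overline u^{(n)}(x)=\max\Big\{0,\ \max_j\big(\overline u^{(n)}_j+\langle x-\theta^{(n)}_j,\overline p^{(n)}_j\rangle\big)\Big\},\qquad x\in X.$$ Then: (a) The sequence $(\overline u^{(n)})$ has a subsequence that converges uniformly on $X$, and the uniform limit of any uniformly convergent subsequence is an optimal solution of the multi-bidder Rochet–Choné problem. (b) The maximum of $\int_X(\langle x,\nabla u(x)\rangle-u(x))\,d\mu(x)$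 over feasible $u$ is attained, and $$\lim_{n\to\infty}\sum_j\mu^{(n)}_j\big(\langle\theta^{(n)}_j,\overline p^{(n)}_j\rangle-\overline u^{(n)}_j\big)=\max_{u\ \text{feasible}}\int_X\big(\langle x,\nabla u(x)\rangle-u(x)\big)\,d\mu(x).$$ -/

import Mathlib

open MeasureTheory Filter Topology

namespace RochetChone

noncomputable section

/-- The type space `X = [0,1]^I`. -/
def typeSpace (I : ℕ) : Set (Fin I → ℝ) := Set.Icc 0 1

/-- The distribution `μ` of types: density `ρ` on `X`, no mass outside `X`. -/
def typeDist {I : ℕ} (ρ : (Fin I → ℝ) → ℝ) : Measure (Fin I → ℝ) :=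
  (volume.restrict (typeSpace I)).withDensity fun x => ENNReal.ofReal (ρ x)

/-- `η`, the law of `ξ^(B-1)` for `ξ` uniform on `[0,1]`. -/
def majorant (B : ℕ) : Measure ℝ :=
  (volume.restrict (Set.Icc (0 : ℝ) 1)).map fun z => z ^ (B - 1)

/-- Majorization `ν' ≼ ν`: every convex non-decreasing test function has the larger integral
against `ν`. For finite measures carried by the non-negative half-line, where a convex
non-decreasing function is bounded below, `∫ φ ∂ν'` is a well-defined element of `(-∞, +∞]`;
the inequality says nothing if `∫ φ ∂ν = +∞`, and includes finiteness of `∫ φ ∂ν'` otherwise. -/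
def MajorizedBy (ν' ν : Measure ℝ) : Prop :=
  ∀ φ : ℝ → ℝ, ConvexOn ℝ Set.univ φ → Monotone φ → Integrable φ ν →
    Integrable φ ν' ∧ ∫ t, φ t ∂ν' ≤ ∫ t, φ t ∂ν

/-- The partial derivative `∂u/∂x_i`. A convex function on `X` is differentiable at almost every
point of the interior of `X`, and there this value depends only on the restriction of `u` to `X`;
the remaining points are a null set. -/
def partialDeriv {I : ℕ} (u : (Fin I → ℝ) → ℝ) (i : Fin I) (x : Fin I → ℝ) : ℝ :=
  fderiv ℝ u x (Pi.single i 1)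

/-- The class of convex non-decreasing `u : X → [0,∞)` with `u(0) = 0` that are `1`-Lipschitz for
the `ℓ¹` distance (only the values of `u` on `X` matter). -/
structure IsLipUtility {I : ℕ} (u : (Fin I → ℝ) → ℝ) : Prop where
  convexOn : ConvexOn ℝ (typeSpace I) u
  monotoneOn : MonotoneOn u (typeSpace I)
  nonneg : ∀ x ∈ typeSpace I, 0 ≤ u x
  map_zero : u 0 = 0
  lipschitz : ∀ x ∈ typeSpace I, ∀ y ∈ typeSpace I, |u x - u y| ≤ ∑ i, |x i - y i|

/-- `∫_X (⟨x, ∇u(x)⟩ - u(x)) dμ(x)`. -/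
def revenuePerBidder {I : ℕ} (ρ : (Fin I → ℝ) → ℝ) (u : (Fin I → ℝ) → ℝ) : ℝ :=
  ∫ x, ((∑ i, x i * partialDeriv u i x) - u x) ∂(typeDist ρ)

/-- Feasible utilities: the law under `μ` of every partial derivative is majorized by `η`. -/
structure IsFeasible {I : ℕ} (B : ℕ) (ρ : (Fin I → ℝ) → ℝ) (u : (Fin I → ℝ) → ℝ) : Prop where
  isLipUtility : IsLipUtility u
  majorized : ∀ i, MajorizedBy ((typeDist ρ).map (partialDeriv u i)) (majorant B)

/-- `u` is an optimal solution of the multi-bidder Rochet-Choné problem. -/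
structure IsOptimal {I : ℕ} (B : ℕ) (ρ : (Fin I → ℝ) → ℝ) (u : (Fin I → ℝ) → ℝ) : Prop where
  feasible : IsFeasible B ρ u
  optimal : ∀ v, IsFeasible B ρ v →
    (B : ℝ) * revenuePerBidder ρ v ≤ (B : ℝ) * revenuePerBidder ρ u

/-- The (closed) grid cube of edge length `1/n` with index `j`. -/
def cell {I n : ℕ} (j : Fin I → Fin n) : Set (Fin I → ℝ) :=
  Set.Icc (fun i => ((j i : ℕ) : ℝ) / n) (fun i => (((j i : ℕ) : ℝ) + 1) / n)

/-- The center `θ_j` of the cube `cell j`. -/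
def center {I n : ℕ} (j : Fin I → Fin n) : Fin I → ℝ :=
  fun i => (((j i : ℕ) : ℝ) + 1 / 2) / n

/-- `μ_j = n^{-I} min_{cell j} ρ`. -/
def weight {I n : ℕ} (ρ : (Fin I → ℝ) → ℝ) (j : Fin I → Fin n) : ℝ :=
  1 / (n : ℝ) ^ I * sInf (ρ '' cell j)

/-- `μ_0 = 1 - ∑_j μ_j`. -/
def restWeight {I : ℕ} (n : ℕ) (ρ : (Fin I → ℝ) → ℝ) : ℝ :=
  1 - ∑ j : Fin I → Fin n, weight ρ j

/-- `μ_0 δ_0 + ∑_j μ_j δ_{p_{j,k}}`. -/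
def discreteLaw {I n : ℕ} (ρ : (Fin I → ℝ) → ℝ) (p : (Fin I → Fin n) → Fin I → ℝ)
    (k : Fin I) : Measure ℝ :=
  ENNReal.ofReal (restWeight n ρ) • Measure.dirac 0 +
    ∑ j : Fin I → Fin n, ENNReal.ofReal (weight ρ j) • Measure.dirac (p j k)

/-- The objective of the discretized program. -/
def discreteValue {I n : ℕ} (ρ : (Fin I → ℝ) → ℝ) (u : (Fin I → Fin n) → ℝ)
    (p : (Fin I → Fin n) → Fin I → ℝ) : ℝ :=
  ∑ j, weight ρ j * ((∑ i, center j i * p j i) - u j)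

/-- The constraints of the discretized program. -/
structure IsDiscreteFeasible {I n : ℕ} (B : ℕ) (ρ : (Fin I → ℝ) → ℝ) (u : (Fin I → Fin n) → ℝ)
    (p : (Fin I → Fin n) → Fin I → ℝ) : Prop where
  ir : ∀ j, 0 ≤ u j
  fs : ∀ j k, 0 ≤ p j k ∧ p j k ≤ 1
  ic : ∀ i j, ∑ k, (center i k - center j k) * p j k ≤ u i - u j
  mj : ∀ k, MajorizedBy (discreteLaw ρ p k) (majorant B)

/-- `(u, p)` is an optimal solution of the discretized program. -/
structure IsDiscreteOptimal {I n : ℕ} (B : ℕ) (ρ : (Fin I → ℝ) → ℝ) (u : (Fin I → Fin n) → ℝ)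
    (p : (Fin I → Fin n) → Fin I → ℝ) : Prop where
  feasible : IsDiscreteFeasible B ρ u p
  optimal : ∀ (u' : (Fin I → Fin n) → ℝ) (p' : (Fin I → Fin n) → Fin I → ℝ),
    IsDiscreteFeasible B ρ u' p' → discreteValue ρ u' p' ≤ discreteValue ρ u p

/-- `x ↦ max {0, max_j (u_j + ⟨x - θ_j, p_j⟩)}`. -/
def extension {I n : ℕ} (u : (Fin I → Fin n) → ℝ) (p : (Fin I → Fin n) → Fin I → ℝ)
    (x : Fin I → ℝ) : ℝ :=
  max 0 (⨆ j, (u j + ∑ i, (x i - center j i) * p j i))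

end

end RochetChone

open RochetChone

/-! Solutions are transferred in both directions between the discrete and the continuous problem,
and every limit is taken by dominated convergence on half-open cells.

From discrete to continuous: by incentive compatibility `p_j` is a subgradient of the extension at
`θ_j`. The extensions have slopes in `[0,1]`, and optimality forces them to vanish at `0`, so they
lie in a class compact by Arzelà–Ascoli. When they converge to `v`, their subgradients converge to
`∇v` wherever `v` is differentiable, hence almost everywhere. The majorization inequalities and the
objective therefore pass to the limit (`isFeasible_and_tendsto_discreteValue`).

From continuous to discrete: a feasible `w` is replaced by the cell averages of `w` and `∇w`.
Integrating the gradient inequality over translated cells gives incentive compatibility. Jensen's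
inequality gives majorization, since moving the mass left over by the minimum of `ρ` to `0` only
lowers a non-decreasing test function (`IsFeasible.isDiscreteFeasible_average`). The discrete values
of these averages tend to the revenue of `w`.

Hence every limit `v` earns at least as much as every feasible `w`. This also proves that the
maximum is attained, and its uniqueness as a number makes the whole sequence of discrete values
converge. -/

namespace RochetChone

variable {I : ℕ}

/-! ### The half-open grid -/

/-- The half-open grid cube with index `j`. -/
def cellIco {I n : ℕ} (j : Fin I → Fin n) : Set (Fin I → ℝ) :=
  Set.univ.pi fun i => Set.Ico (((j i : ℕ) : ℝ) / n) ((((j i : ℕ) : ℝ) + 1) / n)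

section grid

variable {n : ℕ}

theorem mem_cellIco {j : Fin I → Fin n} {x : Fin I → ℝ} :
    x ∈ cellIco j ↔ ∀ i, ((j i : ℕ) : ℝ) / n ≤ x i ∧ x i < (((j i : ℕ) : ℝ) + 1) / n := by
  simp [cellIco, Set.mem_pi]

theorem cellIco_subset_cell (j : Fin I → Fin n) : cellIco j ⊆ cell j := fun _ hx =>
  ⟨fun i => (mem_cellIco.1 hx i).1, fun i => (mem_cellIco.1 hx i).2.le⟩

theorem measurableSet_cellIco (j : Fin I → Fin n) : MeasurableSet (cellIco j) :=
  MeasurableSet.univ_pi fun _ => measurableSet_Ico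

theorem cell_subset_typeSpace (hn : 1 ≤ n) (j : Fin I → Fin n) : cell j ⊆ typeSpace I := by
  have hn' : (0 : ℝ) < n := by exact_mod_cast hn
  rintro x ⟨h0, h1⟩
  refine ⟨fun i => le_trans ?_ (h0 i), fun i => (h1 i).trans ?_⟩
  · simp only [Pi.zero_apply]; positivity
  · have : ((j i : ℕ) : ℝ) + 1 ≤ n := by exact_mod_cast (j i).2
    simpa using (div_le_one hn').2 this

theorem cellIco_subset_typeSpace (hn : 1 ≤ n) (j : Fin I → Fin n) : cellIco j ⊆ typeSpace I :=
  (cellIco_subset_cell j).trans (cell_subset_typeSpace hn j)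

theorem center_mem_cell (j : Fin I → Fin n) : center j ∈ cell j := by
  constructor <;> intro i <;> simp only [center] <;> gcongr <;> linarith

theorem cell_nonempty (j : Fin I → Fin n) : (cell j).Nonempty := ⟨_, center_mem_cell j⟩

theorem isCompact_cell (j : Fin I → Fin n) : IsCompact (cell j) := isCompact_Icc

theorem abs_sub_le_of_mem_cell {j : Fin I → Fin n} {x y : Fin I → ℝ} (hx : x ∈ cell j)
    (hy : y ∈ cell j) (i : Fin I) : |x i - y i| ≤ 1 / n := by
  have h1 := hx.1 i; have h2 := hx.2 i; have h3 := hy.1 i; have h4 := hy.2 i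
  simp only at h1 h2 h3 h4
  rw [add_div] at h2 h4
  rw [abs_le]; constructor <;> linarith

theorem volume_real_cellIco (hn : 1 ≤ n) (j : Fin I → Fin n) :
    volume.real (cellIco j) = 1 / (n : ℝ) ^ I := by
  have hn' : (0 : ℝ) < n := by exact_mod_cast hn
  rw [Measure.real, cellIco, Real.volume_pi_Ico_toReal]
  · simp [← sub_div]
  · intro i; simp only; gcongr; linarith

theorem volume_cellIco_ne_top (j : Fin I → Fin n) : volume (cellIco j) ≠ ⊤ :=
  ((measure_mono (cellIco_subset_cell j)).trans_lt (isCompact_cell j).measure_lt_top).ne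

theorem volume_cellIco_ne_zero (hn : 1 ≤ n) (j : Fin I → Fin n) : volume (cellIco j) ≠ 0 := by
  have hn' : (0 : ℝ) < n := by exact_mod_cast hn
  intro h
  have h1 := volume_real_cellIco hn j
  rw [Measure.real, h, ENNReal.toReal_zero] at h1
  have : (0 : ℝ) < 1 / (n : ℝ) ^ I := by positivity
  linarith

theorem eq_of_mem_cellIco {j j' : Fin I → Fin n} {x : Fin I → ℝ} (hx : x ∈ cellIco j)
    (hx' : x ∈ cellIco j') : j = j' := by
  funext i
  have hn : (0 : ℝ) < n := by exact_mod_cast (Nat.zero_le _).trans_lt (j i).2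
  obtain ⟨a1, a2⟩ := mem_cellIco.1 hx i
  obtain ⟨b1, b2⟩ := mem_cellIco.1 hx' i
  rw [div_le_iff₀ hn] at a1 b1
  rw [lt_div_iff₀ hn] at a2 b2
  have h1 : ((j i : ℕ) : ℝ) < (j' i : ℕ) + 1 := by linarith
  have h2 : ((j' i : ℕ) : ℝ) < (j i : ℕ) + 1 := by linarith
  have h1' : (j i : ℕ) < (j' i : ℕ) + 1 := by exact_mod_cast h1
  have h2' : (j' i : ℕ) < (j i : ℕ) + 1 := by exact_mod_cast h2
  exact Fin.ext (by omega)

/-- The open cube. -/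
def openCube (I : ℕ) : Set (Fin I → ℝ) := Set.univ.pi fun _ => Set.Ioo 0 1

theorem openCube_subset_typeSpace : openCube I ⊆ typeSpace I := fun _ hx =>
  ⟨fun i => (hx i trivial).1.le, fun i => (hx i trivial).2.le⟩

theorem isOpen_openCube : IsOpen (openCube I) :=
  isOpen_set_pi Set.finite_univ fun _ _ => isOpen_Ioo

theorem openCube_ae_eq : openCube I =ᵐ[volume] typeSpace I := by
  simpa [openCube, typeSpace, volume_pi] using
    Measure.univ_pi_Ioo_ae_eq_Icc (μ := fun _ : Fin I => (volume : Measure ℝ)) (f := 0) (g := 1)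

/-- Discarding the null boundary serves two purposes: interior points lie in a unique half-open
cell, and differentiability within the cube is there ordinary differentiability. -/
theorem ae_mem_openCube : ∀ᵐ x ∂(volume.restrict (typeSpace I)), x ∈ openCube I := by
  rw [← Measure.restrict_congr_set (openCube_ae_eq (I := I))]
  exact ae_restrict_mem isOpen_openCube.measurableSet

theorem measurableSet_typeSpace : MeasurableSet (typeSpace I) := measurableSet_Icc

theorem isCompact_typeSpace : IsCompact (typeSpace I) := isCompact_Icc

theorem convex_typeSpace : Convex ℝ (typeSpace I) := convex_Icc 0 1

theorem zero_mem_typeSpace : (0 : Fin I → ℝ) ∈ typeSpace I := ⟨le_rfl, zero_le_one⟩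

instance : IsFiniteMeasure (volume.restrict (typeSpace I)) :=
  ⟨by simpa using isCompact_typeSpace.measure_lt_top⟩

theorem exists_mem_cellIco (hn : 1 ≤ n) {x : Fin I → ℝ} (hx : x ∈ openCube I) :
    ∃ j : Fin I → Fin n, x ∈ cellIco j := by
  have hn' : (0 : ℝ) < n := by exact_mod_cast hn
  have h0 : ∀ i, 0 ≤ (n : ℝ) * x i := fun i => mul_nonneg hn'.le (hx i trivial).1.le
  -- Strictness of `x i < 1` keeps the floor below `n`.
  refine ⟨fun i => ⟨⌊(n : ℝ) * x i⌋₊, ?_⟩, mem_cellIco.2 fun i => ⟨?_, ?_⟩⟩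
  · rw [Nat.floor_lt (h0 i)]
    nlinarith [(hx i trivial).2]
  · exact (div_le_iff₀' hn').2 (Nat.floor_le (h0 i))
  · exact (lt_div_iff₀' hn').2 (Nat.lt_floor_add_one _)

theorem setIntegral_cellIco_const (hn : 1 ≤ n) (j : Fin I → Fin n) (c : ℝ) :
    ∫ _ in cellIco j, c = 1 / (n : ℝ) ^ I * c := by
  rw [setIntegral_const, volume_real_cellIco hn, smul_eq_mul]

/-- Sums of integrals over the cells are integrals over the cube of the glued function. -/
theorem sum_setIntegral_eq_integral_indicator (hn : 1 ≤ n)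
    (F : (Fin I → Fin n) → (Fin I → ℝ) → ℝ)
    (hF : ∀ j, IntegrableOn (F j) (cellIco j)) :
    ∑ j, ∫ x in cellIco j, F j x =
      ∫ x in typeSpace I, ∑ j, (cellIco j).indicator (F j) x := by
  rw [integral_finsetSum]
  · refine Finset.sum_congr rfl fun j _ => ?_
    rw [integral_indicator (measurableSet_cellIco j),
      Measure.restrict_restrict (measurableSet_cellIco j),
      Set.inter_eq_self_of_subset_left (cellIco_subset_typeSpace hn j)]
  · intro j _
    rw [integrable_indicator_iff (measurableSet_cellIco j), IntegrableOn,
      Measure.restrict_restrict (measurableSet_cellIco j),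
      Set.inter_eq_self_of_subset_left (cellIco_subset_typeSpace hn j)]
    exact hF j

theorem sum_indicator_cellIco (F : (Fin I → Fin n) → (Fin I → ℝ) → ℝ) {j : Fin I → Fin n}
    {x : Fin I → ℝ} (hx : x ∈ cellIco j) :
    ∑ i, (cellIco i).indicator (F i) x = F j x := by
  rw [Finset.sum_eq_single j, Set.indicator_of_mem hx]
  · intro i _ hij
    exact Set.indicator_of_notMem (fun h => hij (eq_of_mem_cellIco h hx)) _
  · simp

theorem sum_setIntegral_cellIco (hn : 1 ≤ n) {h : (Fin I → ℝ) → ℝ}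
    (hh : IntegrableOn h (typeSpace I)) :
    ∑ j : Fin I → Fin n, ∫ x in cellIco j, h x = ∫ x in typeSpace I, h x := by
  rw [sum_setIntegral_eq_integral_indicator hn (fun _ => h)
    fun j => hh.mono_set (cellIco_subset_typeSpace hn j)]
  refine integral_congr_ae ?_
  filter_upwards [ae_mem_openCube] with x hx
  obtain ⟨j, hj⟩ := exists_mem_cellIco hn hx
  exact sum_indicator_cellIco (fun _ => h) hj

/-- Dominated convergence for functions given cell by cell on finer and finer grids. -/
theorem tendsto_sum_setIntegral_cellIco {m : ℕ → ℕ} (hm : ∀ k, 1 ≤ m k)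
    (F : ∀ k, (Fin I → Fin (m k)) → (Fin I → ℝ) → ℝ) (g : (Fin I → ℝ) → ℝ) (K : ℝ)
    (hmeas : ∀ k j, AEStronglyMeasurable (F k j) (volume.restrict (typeSpace I)))
    (hbd : ∀ k j, ∀ᵐ x ∂(volume.restrict (typeSpace I)), |F k j x| ≤ K)
    (hlim : ∀ᵐ x ∂(volume.restrict (typeSpace I)), ∀ J : ∀ k, Fin I → Fin (m k),
      (∀ k, x ∈ cellIco (J k)) → Tendsto (fun k => F k (J k) x) atTop (𝓝 (g x))) :
    Tendsto (fun k => ∑ j, ∫ x in cellIco j, F k j x) atTop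
      (𝓝 (∫ x in typeSpace I, g x)) := by
  have hint : ∀ k j, IntegrableOn (F k j) (typeSpace I) := fun k j =>
    Integrable.of_bound (hmeas k j) K (by simpa only [Real.norm_eq_abs] using hbd k j)
  simp_rw [fun k => sum_setIntegral_eq_integral_indicator (hm k) (F k)
    fun j => (hint k j).mono_set (cellIco_subset_typeSpace (hm k) j)]
  refine tendsto_integral_of_dominated_convergence (fun _ => K) ?_ (integrable_const K) ?_ ?_
  · intro k
    exact Finset.aestronglyMeasurable_fun_sum _ fun j _ =>
      (hmeas k j).indicator (measurableSet_cellIco j)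
  · intro k
    filter_upwards [ae_mem_openCube, ae_all_iff.2 (hbd k)] with x hx hb
    obtain ⟨j, hj⟩ := exists_mem_cellIco (hm k) hx
    rw [sum_indicator_cellIco (F k) hj]
    exact hb j
  · filter_upwards [ae_mem_openCube, hlim] with x hx hl
    choose J hJ using fun k => exists_mem_cellIco (hm k) hx
    refine (hl J hJ).congr fun k => ?_
    rw [sum_indicator_cellIco (F k) (hJ k)]

theorem tendsto_of_mem_cell {m : ℕ → ℕ} (hm : Tendsto m atTop atTop) {x : Fin I → ℝ}
    {J : ∀ k, Fin I → Fin (m k)} (hJ : ∀ k, x ∈ cellIco (J k)) {y : ℕ → Fin I → ℝ}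
    (hy : ∀ k, y k ∈ cell (J k)) : Tendsto y atTop (𝓝 x) := by
  rw [tendsto_pi_nhds]
  intro i
  rw [tendsto_iff_dist_tendsto_zero]
  refine squeeze_zero (fun _ => dist_nonneg)
    (fun k => abs_sub_le_of_mem_cell (hy k) (cellIco_subset_cell _ (hJ k)) i) ?_
  exact tendsto_one_div_atTop_nhds_zero_nat.comp hm

end grid

/-! ### Differentiability of utilities -/

theorem fderiv_eq_sum_partialDeriv (u : (Fin I → ℝ) → ℝ) (x d : Fin I → ℝ) :
    fderiv ℝ u x d = ∑ i, d i * partialDeriv u i x := by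
  conv_lhs => rw [pi_eq_sum_univ' d]
  simp [partialDeriv]

theorem measurable_partialDeriv (u : (Fin I → ℝ) → ℝ) (i : Fin I) :
    Measurable (partialDeriv u i) :=
  (measurable_fderiv_apply_const ℝ u _)

theorem IsLipUtility.lipschitzOnWith {u : (Fin I → ℝ) → ℝ} (hu : IsLipUtility u) :
    LipschitzOnWith I u (typeSpace I) := by
  refine LipschitzOnWith.of_dist_le_mul fun x hx y hy => ?_
  refine (hu.lipschitz x hx y hy).trans ?_
  calc ∑ i, |x i - y i| ≤ ∑ _i : Fin I, dist x y :=
        Finset.sum_le_sum fun i _ => dist_le_pi_dist x y i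
    _ = _ := by simp

theorem IsLipUtility.continuousOn {u : (Fin I → ℝ) → ℝ} (hu : IsLipUtility u) :
    ContinuousOn u (typeSpace I) := hu.lipschitzOnWith.continuousOn

theorem IsLipUtility.le_card {u : (Fin I → ℝ) → ℝ} (hu : IsLipUtility u) {x : Fin I → ℝ}
    (hx : x ∈ typeSpace I) : u x ≤ I := by
  have h := hu.lipschitz x hx 0 zero_mem_typeSpace
  rw [hu.map_zero, sub_zero] at h
  refine (le_abs_self _).trans (h.trans ?_)
  calc ∑ i, |x i - (0 : Fin I → ℝ) i| ≤ ∑ _i : Fin I, (1 : ℝ) :=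
        Finset.sum_le_sum fun i _ => by
          simp only [Pi.zero_apply, sub_zero]
          rw [abs_of_nonneg (hx.1 i)]; exact hx.2 i
    _ = _ := by simp

/-- Rademacher's theorem, applied within the cube and upgraded at interior points. -/
theorem IsLipUtility.ae_differentiableAt {u : (Fin I → ℝ) → ℝ} (hu : IsLipUtility u) :
    ∀ᵐ x ∂(volume.restrict (typeSpace I)), DifferentiableAt ℝ u x := by
  filter_upwards [ae_mem_openCube,
    hu.lipschitzOnWith.ae_differentiableWithinAt measurableSet_typeSpace] with x hx hd
  exact hd.differentiableAt
    (mem_of_superset (isOpen_openCube.mem_nhds hx) openCube_subset_typeSpace)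

theorem tendsto_lineSlope {u : (Fin I → ℝ) → ℝ} {x : Fin I → ℝ} (hd : DifferentiableAt ℝ u x)
    (d : Fin I → ℝ) :
    Tendsto (fun t : ℝ => t⁻¹ * (u (x + t • d) - u x)) (𝓝[≠] 0) (𝓝 (fderiv ℝ u x d)) := by
  simpa using (hd.hasFDerivAt.hasLineDerivAt d).tendsto_slope_zero

/-- By convexity the slope over a fraction `t` of the segment is at most the full increment; let `t`
decrease to `0`. -/
theorem fderiv_le_sub {u : (Fin I → ℝ) → ℝ} (hu : ConvexOn ℝ (typeSpace I) u) {x y : Fin I → ℝ}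
    (hx : x ∈ typeSpace I) (hy : y ∈ typeSpace I) (hd : DifferentiableAt ℝ u x) :
    fderiv ℝ u x (y - x) ≤ u y - u x := by
  refine le_of_tendsto ((tendsto_lineSlope hd (y - x)).mono_left
    (nhdsWithin_mono _ fun t (ht : t ∈ Set.Ioi (0 : ℝ)) => (ne_of_gt ht : t ≠ 0))) ?_
  filter_upwards [Ioo_mem_nhdsGT (zero_lt_one (α := ℝ))] with t ht
  have h := hu.2 hx hy (sub_nonneg.2 ht.2.le) ht.1.le (sub_add_cancel 1 t)
  have e : (1 - t) • x + t • y = x + t • (y - x) := by module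
  rw [e, smul_eq_mul, smul_eq_mul] at h
  rw [inv_mul_le_iff₀ ht.1]
  linarith

theorem eventually_add_smul_mem_typeSpace {x : Fin I → ℝ} (hx : x ∈ openCube I)
    (d : Fin I → ℝ) : ∀ᶠ t : ℝ in 𝓝 0, x + t • d ∈ typeSpace I := by
  have h : Tendsto (fun t : ℝ => x + t • d) (𝓝 0) (𝓝 (x + (0 : ℝ) • d)) :=
    Continuous.tendsto (by fun_prop) 0
  rw [zero_smul, add_zero] at h
  exact h (mem_of_superset (isOpen_openCube.mem_nhds hx) openCube_subset_typeSpace)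

/-- Forward difference quotients along a coordinate are non-negative by monotonicity, and at most
`1` because a step `t` has `ℓ¹` length `t`. -/
theorem IsLipUtility.partialDeriv_mem_Icc {u : (Fin I → ℝ) → ℝ} (hu : IsLipUtility u)
    {x : Fin I → ℝ} (hx : x ∈ openCube I) (hd : DifferentiableAt ℝ u x) (i : Fin I) :
    partialDeriv u i x ∈ Set.Icc 0 1 := by
  refine isClosed_Icc.mem_of_tendsto ((tendsto_lineSlope hd (Pi.single i 1)).mono_left
    (nhdsWithin_mono _ fun t (ht : t ∈ Set.Ioi (0 : ℝ)) => (ne_of_gt ht : t ≠ 0))) ?_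
  filter_upwards [self_mem_nhdsWithin,
    (eventually_add_smul_mem_typeSpace hx (Pi.single i 1)).filter_mono nhdsWithin_le_nhds]
    with t ht hmem
  have ht' : (0 : ℝ) < t := ht
  have hx' := openCube_subset_typeSpace hx
  have h1 : u x ≤ u (x + t • Pi.single i 1) := hu.monotoneOn hx' hmem fun l => by
    simp only [Pi.add_apply, Pi.smul_apply, smul_eq_mul, le_add_iff_nonneg_right]
    refine mul_nonneg ht'.le ?_
    by_cases h : l = i
    · subst h; simp
    · simp [h]
  have h2 := (le_abs_self _).trans (hu.lipschitz _ hmem x hx')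
  have e : ∑ l, |(x + t • (Pi.single i 1 : Fin I → ℝ)) l - x l| = t := by
    rw [Finset.sum_eq_single i]
    · simp [abs_of_pos ht']
    · intro b _ hb; simp [hb]
    · simp
  rw [e] at h2
  constructor
  · exact mul_nonneg (inv_nonneg.2 ht'.le) (by linarith)
  · rw [inv_mul_le_iff₀ ht']; linarith

theorem ae_partialDeriv_mem_Icc {u : (Fin I → ℝ) → ℝ} (hu : IsLipUtility u) (i : Fin I) :
    ∀ᵐ x ∂(volume.restrict (typeSpace I)), partialDeriv u i x ∈ Set.Icc 0 1 := by
  filter_upwards [ae_mem_openCube, hu.ae_differentiableAt] with x hx hd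
  exact hu.partialDeriv_mem_Icc hx hd i

theorem IsLipUtility.integrableOn {u : (Fin I → ℝ) → ℝ} (hu : IsLipUtility u) :
    IntegrableOn u (typeSpace I) :=
  hu.continuousOn.integrableOn_compact isCompact_typeSpace

theorem integrableOn_comp_partialDeriv {u : (Fin I → ℝ) → ℝ} (hu : IsLipUtility u) (i : Fin I)
    {φ : ℝ → ℝ} (hφ : Continuous φ) :
    IntegrableOn (fun x => φ (partialDeriv u i x)) (typeSpace I) := by
  obtain ⟨K, hK⟩ := (isCompact_Icc (a := (0 : ℝ)) (b := 1)).exists_bound_of_continuousOn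
    hφ.continuousOn
  refine Integrable.of_bound
    (hφ.measurable.comp (measurable_partialDeriv u i)).aestronglyMeasurable K ?_
  filter_upwards [ae_partialDeriv_mem_Icc hu i] with x hx using hK _ hx

/-! ### The type distribution -/

theorem integral_typeDist {ρ : (Fin I → ℝ) → ℝ} (hρ : ContinuousOn ρ (typeSpace I))
    (h0 : ∀ x ∈ typeSpace I, 0 ≤ ρ x) (f : (Fin I → ℝ) → ℝ) :
    ∫ x, f x ∂(typeDist ρ) = ∫ x in typeSpace I, ρ x * f x := by
  rw [typeDist, integral_withDensity_eq_integral_toReal_smul₀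
    (hρ.aemeasurable measurableSet_typeSpace).ennreal_ofReal (by simp)]
  refine setIntegral_congr_fun measurableSet_typeSpace fun x hx => ?_
  simp [ENNReal.toReal_ofReal (h0 x hx)]

theorem IntegrableOn.density_mul {ρ : (Fin I → ℝ) → ℝ} (hρ : ContinuousOn ρ (typeSpace I))
    {f : (Fin I → ℝ) → ℝ} (hf : IntegrableOn f (typeSpace I)) :
    IntegrableOn (fun x => ρ x * f x) (typeSpace I) :=
  hf.continuousOn_mul hρ isCompact_typeSpace

theorem integrable_typeDist {ρ : (Fin I → ℝ) → ℝ} (hρ : ContinuousOn ρ (typeSpace I))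
    (h0 : ∀ x ∈ typeSpace I, 0 ≤ ρ x) {f : (Fin I → ℝ) → ℝ}
    (hf : IntegrableOn f (typeSpace I)) : Integrable f (typeDist ρ) := by
  rw [typeDist, integrable_withDensity_iff_integrable_smul₀'
    (hρ.aemeasurable measurableSet_typeSpace).ennreal_ofReal (by simp)]
  refine (integrableOn_congr_fun (fun x hx => ?_) measurableSet_typeSpace).2
    (IntegrableOn.density_mul hρ hf)
  simp [ENNReal.toReal_ofReal (h0 x hx)]

theorem revenuePerBidder_eq {ρ : (Fin I → ℝ) → ℝ} (hρ : ContinuousOn ρ (typeSpace I))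
    (h0 : ∀ x ∈ typeSpace I, 0 ≤ ρ x) (u : (Fin I → ℝ) → ℝ) :
    revenuePerBidder ρ u =
      ∫ x in typeSpace I, ρ x * ((∑ i, x i * partialDeriv u i x) - u x) :=
  integral_typeDist hρ h0 _

theorem continuous_of_convexOn_univ {φ : ℝ → ℝ} (h : ConvexOn ℝ Set.univ φ) : Continuous φ :=
  continuousOn_univ.1 (h.continuousOn isOpen_univ)

/-- The majorization constraint as a family of integral inequalities over the cube. -/
theorem majorizedBy_map_partialDeriv_iff {ρ : (Fin I → ℝ) → ℝ}
    (hρ : ContinuousOn ρ (typeSpace I)) (h0 : ∀ x ∈ typeSpace I, 0 ≤ ρ x)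
    {u : (Fin I → ℝ) → ℝ} (hu : IsLipUtility u) (i : Fin I) (ν : Measure ℝ) :
    MajorizedBy ((typeDist ρ).map (partialDeriv u i)) ν ↔
      ∀ φ : ℝ → ℝ, ConvexOn ℝ Set.univ φ → Monotone φ → Integrable φ ν →
        ∫ x in typeSpace I, ρ x * φ (partialDeriv u i x) ≤ ∫ t, φ t ∂ν := by
  refine forall_congr' fun φ => forall₃_congr fun hφ _ _ => ?_
  have hc := continuous_of_convexOn_univ hφ
  have hm := (measurable_partialDeriv u i).aemeasurable (μ := typeDist ρ)
  rw [integral_map hm hc.aestronglyMeasurable, integrable_map_measure hc.aestronglyMeasurable hm,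
    integral_typeDist hρ h0]
  -- The partial derivative lies in `[0,1]` almost everywhere, so the integrability clause is
  -- automatic.
  exact and_iff_right (integrable_typeDist hρ h0 (integrableOn_comp_partialDeriv hu i hc))

/-! ### Discrete weights -/

section weights

variable {n : ℕ} {ρ : (Fin I → ℝ) → ℝ}

/-- The minimum of the density on a cell. -/
noncomputable def cellMin (ρ : (Fin I → ℝ) → ℝ) (j : Fin I → Fin n) : ℝ := sInf (ρ '' cell j)

theorem exists_cellMin_eq (hn : 1 ≤ n) (hρ : ContinuousOn ρ (typeSpace I)) (j : Fin I → Fin n) :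
    ∃ y ∈ cell j, cellMin ρ j = ρ y ∧ ∀ x ∈ cell j, ρ y ≤ ρ x := by
  obtain ⟨y, hy, he, hl⟩ := (isCompact_cell j).exists_sInf_image_eq_and_le (cell_nonempty j)
    (hρ.mono (cell_subset_typeSpace hn j))
  exact ⟨y, hy, he, hl⟩

theorem cellMin_le (hn : 1 ≤ n) (hρ : ContinuousOn ρ (typeSpace I)) {j : Fin I → Fin n}
    {x : Fin I → ℝ} (hx : x ∈ cell j) : cellMin ρ j ≤ ρ x := by
  obtain ⟨y, _, he, hl⟩ := exists_cellMin_eq hn hρ j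
  exact he ▸ hl x hx

theorem cellMin_mem {s : Set ℝ} (hn : 1 ≤ n) (hρ : ContinuousOn ρ (typeSpace I))
    (hs : ∀ x ∈ typeSpace I, ρ x ∈ s) (j : Fin I → Fin n) : cellMin ρ j ∈ s := by
  obtain ⟨y, hy, he, _⟩ := exists_cellMin_eq hn hρ j
  exact he ▸ hs y (cell_subset_typeSpace hn j hy)

/-- Discrete sums become sums of cell integrals, the form required for dominated convergence. -/
theorem weight_mul_eq (hn : 1 ≤ n) (j : Fin I → Fin n) (c : ℝ) :
    weight ρ j * c = ∫ _ in cellIco j, cellMin ρ j * c := by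
  rw [setIntegral_cellIco_const hn, weight, cellMin, mul_assoc]

theorem tendsto_cellMin {m : ℕ → ℕ} (hm : Tendsto m atTop atTop) (hm1 : ∀ k, 1 ≤ m k)
    (hρ : ContinuousOn ρ (typeSpace I)) {x : Fin I → ℝ} {J : ∀ k, Fin I → Fin (m k)}
    (hJ : ∀ k, x ∈ cellIco (J k)) : Tendsto (fun k => cellMin ρ (J k)) atTop (𝓝 (ρ x)) := by
  choose y hy he _ using fun k => exists_cellMin_eq (hm1 k) hρ (J k)
  simp_rw [he]
  have hx : x ∈ typeSpace I := cellIco_subset_typeSpace (hm1 0) _ (hJ 0)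
  exact (hρ x hx).tendsto.comp (tendsto_nhdsWithin_iff.2 ⟨tendsto_of_mem_cell hm hJ hy,
    Eventually.of_forall fun k => cell_subset_typeSpace (hm1 k) _ (hy k)⟩)

/-- The atom at `0` collects the excess of `ρ` over its cell minima, so it can be compared with `ρ`
cell by cell. -/
theorem restWeight_mul_eq (hn : 1 ≤ n) (hρ : ContinuousOn ρ (typeSpace I))
    (hmass : ∫ x in typeSpace I, ρ x = 1) (c : ℝ) :
    restWeight n ρ * c = ∑ j : Fin I → Fin n, ∫ x in cellIco j, (ρ x - cellMin ρ j) * c := by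
  have hi := hρ.integrableOn_compact (μ := volume) isCompact_typeSpace
  have h : ∀ j : Fin I → Fin n, ∫ x in cellIco j, (ρ x - cellMin ρ j) * c =
      (∫ x in cellIco j, ρ x) * c - weight ρ j * c := fun j => by
    rw [integral_mul_const, integral_sub (hi.mono_set (cellIco_subset_typeSpace hn j))
      (integrableOn_const (volume_cellIco_ne_top j)), sub_mul, ← mul_one (weight ρ j),
      weight_mul_eq hn, mul_one]
  simp_rw [h]
  rw [Finset.sum_sub_distrib, ← Finset.sum_mul, ← Finset.sum_mul, sum_setIntegral_cellIco hn hi,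
    hmass, restWeight]
  ring

theorem restWeight_nonneg (hn : 1 ≤ n) (hρ : ContinuousOn ρ (typeSpace I))
    (hmass : ∫ x in typeSpace I, ρ x = 1) : 0 ≤ restWeight n ρ := by
  rw [← mul_one (restWeight n ρ), restWeight_mul_eq hn hρ hmass]
  refine Finset.sum_nonneg fun j _ => setIntegral_nonneg (measurableSet_cellIco j) fun x hx => ?_
  rw [mul_one, sub_nonneg]
  exact cellMin_le hn hρ (cellIco_subset_cell j hx)

theorem weight_nonneg (hn : 1 ≤ n) (hρ : ContinuousOn ρ (typeSpace I))
    (h0 : ∀ x ∈ typeSpace I, 0 ≤ ρ x) (j : Fin I → Fin n) : 0 ≤ weight ρ j :=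
  mul_nonneg (by positivity) (cellMin_mem (s := Set.Ici 0) hn hρ h0 j)

theorem weight_pos (hn : 1 ≤ n) (hρ : ContinuousOn ρ (typeSpace I))
    (h0 : ∀ x ∈ typeSpace I, 0 < ρ x) (j : Fin I → Fin n) : 0 < weight ρ j := by
  have hn' : (0 : ℝ) < n := by exact_mod_cast hn
  exact mul_pos (by positivity) (cellMin_mem (s := Set.Ioi 0) hn hρ h0 j)

/-- The discrete majorization constraint as a family of inequalities between finite sums. -/
theorem majorizedBy_discreteLaw_iff (hn : 1 ≤ n) (hρ : ContinuousOn ρ (typeSpace I))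
    (h0 : ∀ x ∈ typeSpace I, 0 ≤ ρ x) (hmass : ∫ x in typeSpace I, ρ x = 1)
    (p : (Fin I → Fin n) → Fin I → ℝ) (k : Fin I) (ν : Measure ℝ) :
    MajorizedBy (discreteLaw ρ p k) ν ↔
      ∀ φ : ℝ → ℝ, ConvexOn ℝ Set.univ φ → Monotone φ → Integrable φ ν →
        restWeight n ρ * φ 0 + ∑ j, weight ρ j * φ (p j k) ≤ ∫ t, φ t ∂ν := by
  refine forall_congr' fun φ => forall₃_congr fun _ _ _ => ?_
  have h1 : Integrable φ (ENNReal.ofReal (restWeight n ρ) • Measure.dirac 0) :=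
    (integrable_dirac (by simp)).smul_measure (by simp)
  have h2 : ∀ j : Fin I → Fin n,
      Integrable φ (ENNReal.ofReal (weight ρ j) • Measure.dirac (p j k)) := fun j =>
    (integrable_dirac (by simp)).smul_measure (by simp)
  have h3 : Integrable φ (∑ j : Fin I → Fin n,
      ENNReal.ofReal (weight ρ j) • Measure.dirac (p j k)) :=
    integrable_finsetSum_measure.2 fun j _ => h2 j
  have h4 : ∫ t, φ t ∂(discreteLaw ρ p k) =
      restWeight n ρ * φ 0 + ∑ j, weight ρ j * φ (p j k) := by
    rw [discreteLaw, integral_add_measure h1 h3, integral_finsetSum_measure fun j _ => h2 j]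
    simp [integral_smul_measure, ENNReal.toReal_ofReal, restWeight_nonneg hn hρ hmass,
      weight_nonneg hn hρ h0]
  rw [h4]
  exact and_iff_right (h1.add_measure h3)

end weights

/-! ### The extension of a discrete solution -/

section extension

variable {n B : ℕ} {ρ : (Fin I → ℝ) → ℝ} {u : (Fin I → Fin n) → ℝ}
  {p : (Fin I → Fin n) → Fin I → ℝ}

theorem extension_le_iff (hn : 1 ≤ n) {x : Fin I → ℝ} {t : ℝ} :
    extension u p x ≤ t ↔ 0 ≤ t ∧ ∀ j, u j + ∑ i, (x i - center j i) * p j i ≤ t := by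
  have : Nonempty (Fin n) := ⟨⟨0, hn⟩⟩
  rw [extension, max_le_iff, ciSup_le_iff (Set.finite_range _).bddAbove]

theorem extension_nonneg (x : Fin I → ℝ) : 0 ≤ extension u p x := le_max_left _ _

theorem le_extension (hn : 1 ≤ n) (x : Fin I → ℝ) (j : Fin I → Fin n) :
    u j + ∑ i, (x i - center j i) * p j i ≤ extension u p x :=
  ((extension_le_iff hn).1 le_rfl).2 j

/-- At `θ_j` the piece of index `j` equals `u j`; incentive compatibility bounds the other pieces
and `ir` bounds the zero piece. -/
theorem IsDiscreteFeasible.extension_center (h : IsDiscreteFeasible B ρ u p) (hn : 1 ≤ n)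
    (j : Fin I → Fin n) : extension u p (center j) = u j := by
  refine le_antisymm ((extension_le_iff hn).2 ⟨h.ir j, fun i => ?_⟩) ?_
  · linarith [h.ic j i]
  · simpa using le_extension (u := u) (p := p) hn (center j) j

/-- At an optimum the lowest type gets utility zero. -/
theorem IsDiscreteOptimal.extension_zero (h : IsDiscreteOptimal B ρ u p) (hn : 1 ≤ n)
    (hw : ∀ j : Fin I → Fin n, 0 < weight ρ j) : extension u p 0 = 0 := by
  obtain ⟨⟨hir, hfs, hic, hmj⟩, hopt⟩ := h
  -- The corner cell has the coordinatewise smallest center and, as slopes are non-negative, the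
  -- smallest utility.
  set c : Fin I → Fin n := fun _ => ⟨0, hn⟩ with hc
  have hcen : ∀ (j : Fin I → Fin n) k, center c k ≤ center j k := fun j k => by
    simp only [center, hc]
    gcongr
    exact Nat.zero_le _
  have hc0 : ∀ k, 0 ≤ center c k := fun k => by simp only [center]; positivity
  -- Lowering all utilities by `u c` stays feasible and raises the value by the total weight times
  -- `u c`, so optimality forces `u c ≤ 0`.
  have key := hopt (fun j => u j - u c) p ⟨fun j => sub_nonneg.2 ?_, hfs, fun i j => by
    linarith [hic i j], hmj⟩
  · have e : discreteValue ρ (fun j => u j - u c) p =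
        discreteValue ρ u p + (∑ j : Fin I → Fin n, weight ρ j) * u c := by
      rw [discreteValue, discreteValue, Finset.sum_mul, ← Finset.sum_add_distrib]
      exact Finset.sum_congr rfl fun j _ => by ring
    rw [e] at key
    have hs : 0 < ∑ j : Fin I → Fin n, weight ρ j :=
      Finset.sum_pos (fun j _ => hw j) ⟨c, Finset.mem_univ _⟩
    have huc : u c ≤ 0 := by
      by_contra! hpos
      nlinarith [mul_pos hs hpos]
    refine le_antisymm ((extension_le_iff hn).2 ⟨le_rfl, fun j => ?_⟩) (extension_nonneg _)
    have h1 := hic c j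
    have h2 : ∑ i, ((0 : Fin I → ℝ) i - center j i) * p j i ≤
        ∑ i, (center c i - center j i) * p j i :=
      Finset.sum_le_sum fun i _ => mul_le_mul_of_nonneg_right
        (by simpa using hc0 i) (hfs j i).1
    linarith
  · have h1 := hic j c
    have h2 : 0 ≤ ∑ k, (center j k - center c k) * p c k :=
      Finset.sum_nonneg fun k _ => mul_nonneg (sub_nonneg.2 (hcen j k)) (hfs c k).1
    linarith

/-- Affine functions with slopes in `[0,1]` are convex, non-decreasing and `1`-Lipschitz for `ℓ¹`;
each property survives a finite maximum. -/
theorem isLipUtility_extension (hn : 1 ≤ n) (hp : ∀ j k, 0 ≤ p j k ∧ p j k ≤ 1)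
    (h0 : extension u p 0 = 0) : IsLipUtility (extension u p) := by
  have hlip : ∀ x y : Fin I → ℝ, extension u p x ≤ extension u p y + ∑ i, |x i - y i| := by
    intro x y
    have hs : 0 ≤ ∑ i, |x i - y i| := Finset.sum_nonneg fun _ _ => abs_nonneg _
    refine (extension_le_iff hn).2 ⟨add_nonneg (extension_nonneg _) hs, fun j => ?_⟩
    have h1 := le_extension (u := u) (p := p) hn y j
    have h2 : ∑ i, (x i - center j i) * p j i ≤
        ∑ i, (y i - center j i) * p j i + ∑ i, |x i - y i| := by
      rw [← Finset.sum_add_distrib]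
      refine Finset.sum_le_sum fun i _ => ?_
      have h3 : (x i - y i) * p j i ≤ |x i - y i| :=
        (mul_le_mul_of_nonneg_right (le_abs_self _) (hp j i).1).trans
          (mul_le_of_le_one_right (abs_nonneg _) (hp j i).2)
      linarith
    linarith
  refine ⟨⟨convex_typeSpace, ?_⟩, ?_, fun x _ => extension_nonneg x, h0, ?_⟩
  · intro x _ y _ a b ha hb hab
    simp only [smul_eq_mul]
    refine (extension_le_iff hn).2 ⟨add_nonneg (mul_nonneg ha (extension_nonneg _))
      (mul_nonneg hb (extension_nonneg _)), fun j => ?_⟩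
    have e : u j + ∑ i, ((a • x + b • y) i - center j i) * p j i =
        a * (u j + ∑ i, (x i - center j i) * p j i) +
          b * (u j + ∑ i, (y i - center j i) * p j i) := by
      have hb' : b = 1 - a := by linarith
      subst hb'
      have : ∀ i, ((a • x + (1 - a) • y) i - center j i) * p j i =
          a * ((x i - center j i) * p j i) + (1 - a) * ((y i - center j i) * p j i) := fun i => by
        simp only [Pi.add_apply, Pi.smul_apply, smul_eq_mul]; ring
      simp_rw [this]
      rw [Finset.sum_add_distrib, ← Finset.mul_sum, ← Finset.mul_sum]
      ring
    rw [e]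
    exact add_le_add (mul_le_mul_of_nonneg_left (le_extension hn x j) ha)
      (mul_le_mul_of_nonneg_left (le_extension hn y j) hb)
  · intro x _ y _ hxy
    refine (extension_le_iff hn).2 ⟨extension_nonneg _, fun j => ?_⟩
    refine le_trans ?_ (le_extension hn y j)
    gcongr with i
    · exact (hp j i).1
    · exact hxy i
  · intro x _ y _
    rw [abs_le]
    have h1 := hlip x y
    have h2 := hlip y x
    have h3 : ∑ i, |y i - x i| = ∑ i, |x i - y i| :=
      Finset.sum_congr rfl fun i _ => abs_sub_comm _ _
    constructor <;> linarith

end extension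

/-! ### Compactness of the class of utilities -/

theorem isLipUtility_of_tendsto {f : ℕ → (Fin I → ℝ) → ℝ} {v : (Fin I → ℝ) → ℝ}
    (hf : ∀ k, IsLipUtility (f k))
    (h : ∀ x ∈ typeSpace I, Tendsto (fun k => f k x) atTop (𝓝 (v x))) : IsLipUtility v := by
  refine ⟨⟨convex_typeSpace, ?_⟩, ?_, fun x hx => ge_of_tendsto' (h x hx) fun k =>
    (hf k).nonneg x hx, ?_, ?_⟩
  · intro x hx y hy a b ha hb hab
    exact le_of_tendsto_of_tendsto' (h _ (convex_typeSpace hx hy ha hb hab))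
      (((h x hx).const_smul a).add ((h y hy).const_smul b))
      fun k => (hf k).convexOn.2 hx hy ha hb hab
  · intro x hx y hy hxy
    exact le_of_tendsto_of_tendsto' (h x hx) (h y hy) fun k => (hf k).monotoneOn hx hy hxy
  · refine tendsto_nhds_unique (h 0 zero_mem_typeSpace) ?_
    simp_rw [(hf _).map_zero]
    exact tendsto_const_nhds
  · intro x hx y hy
    exact le_of_tendsto' ((h x hx).sub (h y hy)).abs fun k => (hf k).lipschitz x hx y hy

/-- Every sequence of utilities has a uniformly convergent subsequence. -/
theorem exists_subseq_tendstoUniformlyOn {f : ℕ → (Fin I → ℝ) → ℝ}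
    (hf : ∀ k, IsLipUtility (f k)) :
    ∃ (s : ℕ → ℕ) (v : (Fin I → ℝ) → ℝ), StrictMono s ∧
      TendstoUniformlyOn (fun k => f (s k)) v atTop (typeSpace I) := by
  have : CompactSpace (typeSpace I) := isCompact_iff_compactSpace.1 isCompact_typeSpace
  let g : ℕ → BoundedContinuousFunction (typeSpace I) ℝ := fun k =>
    BoundedContinuousFunction.mkOfCompact
      ⟨(typeSpace I).domRestrict (f k), (hf k).continuousOn.domRestrict⟩
  have hc : IsCompact (closure (Set.range g)) := by
    -- All utilities take values in `[0, I]` and share the Lipschitz constant `I` for the sup norm.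
    refine BoundedContinuousFunction.arzela_ascoli (Set.Icc 0 (I : ℝ)) isCompact_Icc _ ?_ ?_
    · rintro _ x ⟨k, rfl⟩
      exact ⟨(hf k).nonneg x x.2, (hf k).le_card x.2⟩
    · refine (LipschitzWith.uniformEquicontinuous _ I ?_).equicontinuous
      rintro ⟨_, k, rfl⟩
      exact (hf k).lipschitzOnWith.to_restrict
  obtain ⟨v, _, s, hs, hlim⟩ := hc.tendsto_subseq fun k => subset_closure (Set.mem_range_self k)
  have hu := BoundedContinuousFunction.tendsto_iff_tendstoUniformly.1 hlim
  classical
  refine ⟨s, fun x => if hx : x ∈ typeSpace I then v ⟨x, hx⟩ else 0, hs, ?_⟩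
  rw [tendstoUniformlyOn_iff_tendstoUniformly_comp_coe]
  convert hu using 1
  · funext k x
    rfl
  · funext x
    simp

variable {B : ℕ} {ρ : (Fin I → ℝ) → ℝ}

theorem sum_mul_sub_mem_Icc {x q : Fin I → ℝ} {t : ℝ} (hx : x ∈ typeSpace I)
    (hq : ∀ i, q i ∈ Set.Icc (0 : ℝ) 1) (ht : t ∈ Set.Icc (0 : ℝ) I) :
    |(∑ i, x i * q i) - t| ≤ I := by
  have h1 : 0 ≤ ∑ i, x i * q i := Finset.sum_nonneg fun i _ => mul_nonneg (hx.1 i) (hq i).1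
  have h2 : ∑ i, x i * q i ≤ ∑ _i : Fin I, (1 : ℝ) :=
    Finset.sum_le_sum fun i _ => mul_le_one₀ (hx.2 i) (hq i).1 (hq i).2
  simp only [Finset.sum_const, Finset.card_univ, Fintype.card_fin, nsmul_eq_mul, mul_one] at h2
  rw [abs_le]
  constructor <;> linarith [ht.1, ht.2]

theorem abs_cellMin_le {n : ℕ} {C : ℝ} (hn : 1 ≤ n) (hρ : ContinuousOn ρ (typeSpace I))
    (hC : ∀ x ∈ typeSpace I, 0 ≤ ρ x ∧ ρ x ≤ C) (j : Fin I → Fin n) : |cellMin ρ j| ≤ C := by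
  obtain ⟨h1, h2⟩ := cellMin_mem (s := Set.Icc 0 C) hn hρ hC j
  rwa [abs_of_nonneg h1]

/-! ### From discrete solutions to utilities -/

/-- Riemann sums against the discretized measures converge. -/
theorem tendsto_sum_weight_mul {m : ℕ → ℕ} (hm : Tendsto m atTop atTop) (hm1 : ∀ k, 1 ≤ m k)
    (hρ : ContinuousOn ρ (typeSpace I)) {C : ℝ} (hC : ∀ x ∈ typeSpace I, 0 ≤ ρ x ∧ ρ x ≤ C)
    (G : ∀ k, (Fin I → Fin (m k)) → ℝ) (g : (Fin I → ℝ) → ℝ) (K : ℝ)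
    (hbd : ∀ k j, |G k j| ≤ K)
    (hlim : ∀ᵐ x ∂(volume.restrict (typeSpace I)), ∀ J : ∀ k, Fin I → Fin (m k),
      (∀ k, x ∈ cellIco (J k)) → Tendsto (fun k => G k (J k)) atTop (𝓝 (g x))) :
    Tendsto (fun k => ∑ j, weight ρ j * G k j) atTop
      (𝓝 (∫ x in typeSpace I, ρ x * g x)) := by
  simp_rw [fun k j => weight_mul_eq (ρ := ρ) (hm1 k) j (G k j)]
  refine tendsto_sum_setIntegral_cellIco hm1 (fun k j _ => cellMin ρ j * G k j) _ (C * K)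
    (fun _ _ => aestronglyMeasurable_const) (fun k j => Eventually.of_forall fun x => ?_) ?_
  · rw [abs_mul]
    have h := abs_cellMin_le (hm1 k) hρ hC j
    exact mul_le_mul h (hbd k j) (abs_nonneg _) ((abs_nonneg _).trans h)
  · filter_upwards [hlim] with x hx J hJ
    exact (tendsto_cellMin hm hm1 hρ hJ).mul (hx J hJ)

section limit

variable {m : ℕ → ℕ} {u : ∀ k, (Fin I → Fin (m k)) → ℝ}
  {p : ∀ k, (Fin I → Fin (m k)) → Fin I → ℝ} {v : (Fin I → ℝ) → ℝ}
  {x : Fin I → ℝ} {J : ∀ k, Fin I → Fin (m k)}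

theorem tendsto_sum_abs_sub_center (hm : Tendsto m atTop atTop)
    (hJ : ∀ k, x ∈ cellIco (J k)) :
    Tendsto (fun k => ∑ l, |x l - center (J k) l|) atTop (𝓝 0) := by
  have h := tendsto_pi_nhds.1 (tendsto_of_mem_cell hm hJ fun k => center_mem_cell (J k))
  have h2 : Tendsto (fun k => ∑ l, |x l - center (J k) l|) atTop (𝓝 (∑ l, |x l - x l|)) :=
    tendsto_finsetSum _ fun l _ => (tendsto_const_nhds.sub (h l)).abs
  simpa using h2

/-- The extension interpolates `u` at the centers, and its Lipschitz bound absorbs the vanishing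
distance from `x` to the center. -/
theorem tendsto_discrete_utility (hm : Tendsto m atTop atTop) (hm1 : ∀ k, 1 ≤ m k)
    (hfeas : ∀ k, IsDiscreteFeasible B ρ (u k) (p k))
    (hlip : ∀ k, IsLipUtility (extension (u k) (p k)))
    (hv : ∀ x ∈ typeSpace I, Tendsto (fun k => extension (u k) (p k) x) atTop (𝓝 (v x)))
    (hJ : ∀ k, x ∈ cellIco (J k)) : Tendsto (fun k => u k (J k)) atTop (𝓝 (v x)) := by
  have hx : x ∈ typeSpace I := cellIco_subset_typeSpace (hm1 0) _ (hJ 0)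
  have h : Tendsto (fun k => extension (u k) (p k) x - u k (J k)) atTop (𝓝 0) := by
    refine squeeze_zero_norm (fun k => ?_) (tendsto_sum_abs_sub_center hm hJ)
    rw [← (hfeas k).extension_center (hm1 k) (J k)]
    exact (hlip k).lipschitz x hx _ (cell_subset_typeSpace (hm1 k) _ (center_mem_cell (J k)))
  simpa using (hv x hx).sub h

/-- The subgradient inequality squeezes `p` between backward and forward difference quotients of the
extension, up to a vanishing error. The step `t` is fixed before `k` tends to infinity, so only
convergence of values is needed. -/
theorem tendsto_discrete_gradient (hm : Tendsto m atTop atTop) (hm1 : ∀ k, 1 ≤ m k)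
    (hfeas : ∀ k, IsDiscreteFeasible B ρ (u k) (p k))
    (hlip : ∀ k, IsLipUtility (extension (u k) (p k)))
    (hv : ∀ x ∈ typeSpace I, Tendsto (fun k => extension (u k) (p k) x) atTop (𝓝 (v x)))
    (hx : x ∈ openCube I) (hd : DifferentiableAt ℝ v x)
    (hJ : ∀ k, x ∈ cellIco (J k)) (i : Fin I) :
    Tendsto (fun k => p k (J k) i) atTop (𝓝 (partialDeriv v i x)) := by
  set e : Fin I → ℝ := Pi.single i 1 with he
  have hu := tendsto_discrete_utility hm hm1 hfeas hlip hv hJ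
  have hr := tendsto_sum_abs_sub_center hm hJ
  have hslope := tendsto_lineSlope hd e
  have hmem := eventually_add_smul_mem_typeSpace hx e
  -- Replacing the center by `x` costs at most their `ℓ¹` distance, as the entries of `p` lie in
  -- `[0,1]`.
  have hkey : ∀ (t : ℝ) k, t * p k (J k) i ≤
      extension (u k) (p k) (x + t • e) - u k (J k) + ∑ l, |x l - center (J k) l| := by
    intro t k
    have h1 := le_extension (u := u k) (p := p k) (hm1 k) (x + t • e) (J k)
    have h2 : ∑ l, ((x + t • e) l - center (J k) l) * p k (J k) l =
        t * p k (J k) i + ∑ l, (x l - center (J k) l) * p k (J k) l := by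
      have h3 : t * p k (J k) i = ∑ l, t * e l * p k (J k) l := by
        rw [Finset.sum_eq_single i]
        · simp [he]
        · intro b _ hb; simp [he, hb]
        · simp
      rw [h3, ← Finset.sum_add_distrib]
      refine Finset.sum_congr rfl fun l _ => ?_
      simp only [Pi.add_apply, Pi.smul_apply, smul_eq_mul]
      ring
    have h4 : -∑ l, |x l - center (J k) l| ≤ ∑ l, (x l - center (J k) l) * p k (J k) l := by
      rw [← Finset.sum_neg_distrib]
      refine Finset.sum_le_sum fun l _ => ?_
      have h5 : |x l - center (J k) l| * p k (J k) l ≤ |x l - center (J k) l| :=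
        mul_le_of_le_one_right (abs_nonneg _) ((hfeas k).fs _ l).2
      have h6 : -|x l - center (J k) l| * p k (J k) l ≤ (x l - center (J k) l) * p k (J k) l :=
        mul_le_mul_of_nonneg_right (neg_abs_le _) ((hfeas k).fs _ l).1
      linarith
    linarith
  have hlim : ∀ t : ℝ, x + t • e ∈ typeSpace I → Tendsto (fun k => t⁻¹ *
      (extension (u k) (p k) (x + t • e) - u k (J k) + ∑ l, |x l - center (J k) l|)) atTop
      (𝓝 (t⁻¹ * (v (x + t • e) - v x))) := fun t ht => by
    simpa using (((hv _ ht).sub hu).add hr).const_mul t⁻¹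
  refine tendsto_order.2 ⟨fun a ha => ?_, fun b hb => ?_⟩
  -- A negative step gives the lower bound: dividing `hkey` by `t` reverses it.
  · obtain ⟨t, ⟨ht1, ht2⟩, ht⟩ := (((hslope.eventually (lt_mem_nhds ha)).filter_mono
      (nhdsWithin_mono _ fun t (ht : t ∈ Set.Iio (0 : ℝ)) => (ne_of_lt ht : t ≠ 0))).and
      (hmem.filter_mono nhdsWithin_le_nhds)).and self_mem_nhdsWithin |>.exists
    filter_upwards [(hlim t ht2).eventually (lt_mem_nhds ht1)] with k hk
    refine hk.trans_le ?_
    have ht' : t < 0 := ht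
    have h := mul_le_mul_of_nonpos_left (hkey t k) (inv_lt_zero.2 ht').le
    rwa [inv_mul_cancel_left₀ ht'.ne] at h
  · obtain ⟨t, ⟨ht1, ht2⟩, ht⟩ := (((hslope.eventually (gt_mem_nhds hb)).filter_mono
      (nhdsWithin_mono _ fun t (ht : t ∈ Set.Ioi (0 : ℝ)) => (ne_of_gt ht : t ≠ 0))).and
      (hmem.filter_mono nhdsWithin_le_nhds)).and self_mem_nhdsWithin |>.exists
    filter_upwards [(hlim t ht2).eventually (gt_mem_nhds ht1)] with k hk
    refine lt_of_le_of_lt ?_ hk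
    have ht' : 0 < t := ht
    have h := mul_le_mul_of_nonneg_left (hkey t k) (inv_pos.2 ht').le
    rwa [inv_mul_cancel_left₀ ht'.ne'] at h

/-- Limits of extensions of discrete solutions inherit the majorization constraint, and their
revenue is the limit of the discrete values. -/
theorem isFeasible_and_tendsto_discreteValue (hm : Tendsto m atTop atTop) (hm1 : ∀ k, 1 ≤ m k)
    (hρ : ContinuousOn ρ (typeSpace I)) {C : ℝ} (hC : ∀ x ∈ typeSpace I, 0 ≤ ρ x ∧ ρ x ≤ C)
    (hmass : ∫ x in typeSpace I, ρ x = 1)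
    (hfeas : ∀ k, IsDiscreteFeasible B ρ (u k) (p k))
    (hlip : ∀ k, IsLipUtility (extension (u k) (p k)))
    (hv : ∀ x ∈ typeSpace I, Tendsto (fun k => extension (u k) (p k) x) atTop (𝓝 (v x))) :
    IsFeasible B ρ v ∧
      Tendsto (fun k => discreteValue ρ (u k) (p k)) atTop (𝓝 (revenuePerBidder ρ v)) := by
  have hvu : IsLipUtility v := isLipUtility_of_tendsto hlip hv
  have h0 : ∀ x ∈ typeSpace I, 0 ≤ ρ x := fun x hx => (hC x hx).1
  refine ⟨⟨hvu, fun i => ?_⟩, ?_⟩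
  · rw [majorizedBy_map_partialDeriv_iff hρ h0 hvu]
    intro φ hφ hφm hφi
    have hc := continuous_of_convexOn_univ hφ
    obtain ⟨K, hK⟩ := (isCompact_Icc (a := (0 : ℝ)) (b := 1)).exists_bound_of_continuousOn
      hc.continuousOn
    -- The total weight tends to the mass `1` of `ρ`, so the artificial atom at `0` vanishes.
    have hrest : Tendsto (fun k => restWeight (m k) ρ) atTop (𝓝 0) := by
      have h := tendsto_sum_weight_mul hm hm1 hρ hC (fun _ _ => 1) (fun _ => 1) 1 (by simp)
        (Eventually.of_forall fun _ _ _ => tendsto_const_nhds)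
      simp only [mul_one, hmass] at h
      simpa [restWeight] using h.const_sub 1
    have hsum := tendsto_sum_weight_mul hm hm1 hρ hC (fun k j => φ (p k j i))
      (fun x => φ (partialDeriv v i x)) K (fun k j => hK _ ((hfeas k).fs j i)) (by
        filter_upwards [ae_mem_openCube, hvu.ae_differentiableAt] with x hx hd J hJ
        exact (hc.tendsto _).comp
          (tendsto_discrete_gradient hm hm1 hfeas hlip hv hx hd hJ i))
    have htot := (hrest.mul_const (φ 0)).add hsum
    rw [zero_mul, zero_add] at htot
    exact le_of_tendsto' htot fun k =>
      (majorizedBy_discreteLaw_iff (hm1 k) hρ h0 hmass _ i _).1 ((hfeas k).mj i) φ hφ hφm hφi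
  · rw [revenuePerBidder_eq hρ h0]
    refine tendsto_sum_weight_mul hm hm1 hρ hC
      (fun k j => (∑ i, center j i * p k j i) - u k j) _ I (fun k j => ?_) ?_
    · have hcj := cell_subset_typeSpace (hm1 k) _ (center_mem_cell j)
      refine sum_mul_sub_mem_Icc hcj ((hfeas k).fs j) ⟨(hfeas k).ir j, ?_⟩
      rw [← (hfeas k).extension_center (hm1 k) j]
      exact (hlip k).le_card hcj
    · filter_upwards [ae_mem_openCube, hvu.ae_differentiableAt] with x hx hd J hJ
      have hcen := tendsto_pi_nhds.1 (tendsto_of_mem_cell hm hJ fun k => center_mem_cell (J k))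
      exact (tendsto_finsetSum _ fun i _ => (hcen i).mul
        (tendsto_discrete_gradient hm hm1 hfeas hlip hv hx hd hJ i)).sub
        (tendsto_discrete_utility hm hm1 hfeas hlip hv hJ)

end limit

/-! ### From utilities to discrete solutions -/

section average

variable {n : ℕ} {w : (Fin I → ℝ) → ℝ}

theorem setAverage_cellIco (hn : 1 ≤ n) (j : Fin I → Fin n) (f : (Fin I → ℝ) → ℝ) :
    ⨍ x in cellIco j, f x = (n : ℝ) ^ I * ∫ x in cellIco j, f x := by
  rw [setAverage_eq, volume_real_cellIco hn, smul_eq_mul, one_div, inv_inv]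

theorem weight_mul_setAverage (hn : 1 ≤ n) (j : Fin I → Fin n) (f : (Fin I → ℝ) → ℝ) :
    weight ρ j * ⨍ x in cellIco j, f x = ∫ x in cellIco j, cellMin ρ j * f x := by
  have hn' : (0 : ℝ) < n := by exact_mod_cast hn
  rw [setAverage_cellIco hn, integral_const_mul, weight, cellMin]
  field_simp

/-- Cells of one grid are translates of each other by the difference of their centers. -/
theorem setIntegral_cellIco_eq_add (i j : Fin I → Fin n) (f : (Fin I → ℝ) → ℝ) :
    ∫ x in cellIco i, f x = ∫ x in cellIco j, f (x + (center i - center j)) := by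
  rw [← (measurePreserving_add_right volume (center i - center j)).setIntegral_preimage_emb
    (measurableEmbedding_addRight _) f (cellIco i)]
  congr 2
  ext x
  simp only [Set.mem_preimage, mem_cellIco, center, Pi.add_apply, Pi.sub_apply]
  refine forall_congr' fun k => ?_
  simp only [add_div]
  constructor <;> rintro ⟨h1, h2⟩ <;> constructor <;> linarith

/-- Integrate `⟨∇w(x), d⟩ ≤ w(x + d) - w(x)` over cell `j` with the constant `d = θ_i - θ_j`; the
translation carries cell `j` onto cell `i`. -/
theorem IsLipUtility.average_incentive (hw : IsLipUtility w) (hn : 1 ≤ n)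
    (i j : Fin I → Fin n) :
    ∑ k, (center i k - center j k) * ⨍ x in cellIco j, partialDeriv w k x ≤
      (⨍ x in cellIco i, w x) - ⨍ x in cellIco j, w x := by
  set d : Fin I → ℝ := center i - center j with hdef
  have hsub := cellIco_subset_typeSpace hn j
  have hpi : ∀ k, IntegrableOn (fun x => d k * partialDeriv w k x) (cellIco j) := fun k =>
    ((integrableOn_comp_partialDeriv hw k continuous_id).mono_set hsub).const_mul _
  have hshift : ∀ x ∈ cellIco j, x + d ∈ typeSpace I := fun x hx => by
    refine cellIco_subset_typeSpace hn i (mem_cellIco.2 fun k => ?_)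
    have h := mem_cellIco.1 hx k
    simp only [hdef, center, Pi.add_apply, Pi.sub_apply]
    simp only [add_div] at h ⊢
    constructor <;> linarith [h.1, h.2]
  have hwi : IntegrableOn (fun x => w (x + d)) (cellIco j) := by
    have hcont : ContinuousOn (fun x => w (x + d)) (cellIco j) :=
      hw.continuousOn.comp (by fun_prop) hshift
    have : IsFiniteMeasure (volume.restrict (cellIco j)) :=
      isFiniteMeasure_restrict.2 (volume_cellIco_ne_top j)
    refine Integrable.of_bound (C := I) ?_ ?_
    · exact hcont.aestronglyMeasurable (measurableSet_cellIco j)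
    · filter_upwards [ae_restrict_mem (measurableSet_cellIco j)] with x hx
      rw [Real.norm_of_nonneg (hw.nonneg _ (hshift x hx))]
      exact hw.le_card (hshift x hx)
  have hle : ∫ x in cellIco j, ∑ k, d k * partialDeriv w k x ≤
      ∫ x in cellIco j, (w (x + d) - w x) := by
    refine integral_mono_ae (integrable_finsetSum _ fun k _ => hpi k)
      (hwi.sub (hw.integrableOn.mono_set hsub)) ?_
    filter_upwards [ae_restrict_of_ae_restrict_of_subset hsub hw.ae_differentiableAt,
      ae_restrict_mem (measurableSet_cellIco j)] with x hd hx
    rw [← fderiv_eq_sum_partialDeriv]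
    simpa using fderiv_le_sub hw.convexOn (hsub hx) (hshift x hx) hd
  rw [integral_finsetSum _ fun k _ => hpi k,
    integral_sub hwi (hw.integrableOn.mono_set hsub), ← setIntegral_cellIco_eq_add] at hle
  simp_rw [setAverage_cellIco hn]
  rw [← mul_sub]
  have e : ∑ k, (center i k - center j k) * ((n : ℝ) ^ I * ∫ x in cellIco j, partialDeriv w k x) =
      (n : ℝ) ^ I * ∑ k, ∫ x in cellIco j, d k * partialDeriv w k x := by
    rw [Finset.mul_sum]
    refine Finset.sum_congr rfl fun k _ => ?_
    rw [integral_const_mul, hdef, Pi.sub_apply]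
    ring
  rw [e]
  exact mul_le_mul_of_nonneg_left hle (by positivity)

/-- Cell averages of a feasible utility and of its gradient are feasible for the discretized
program. -/
theorem IsFeasible.isDiscreteFeasible_average (hw : IsFeasible B ρ w) (hn : 1 ≤ n)
    (hρ : ContinuousOn ρ (typeSpace I)) (h0 : ∀ x ∈ typeSpace I, 0 ≤ ρ x)
    (hmass : ∫ x in typeSpace I, ρ x = 1) :
    IsDiscreteFeasible B ρ (fun j : Fin I → Fin n => ⨍ x in cellIco j, w x)
      (fun j k => ⨍ x in cellIco j, partialDeriv w k x) := by
  have hu := hw.isLipUtility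
  have hint : ∀ (j : Fin I → Fin n) k {φ : ℝ → ℝ}, Continuous φ →
      IntegrableOn (fun x => φ (partialDeriv w k x)) (cellIco j) := fun j k φ hφ =>
    (integrableOn_comp_partialDeriv hu k hφ).mono_set (cellIco_subset_typeSpace hn j)
  have hmem : ∀ (j : Fin I → Fin n) k,
      ∀ᵐ x ∂(volume.restrict (cellIco j)), partialDeriv w k x ∈ Set.Icc 0 1 := fun j k =>
    ae_restrict_of_ae_restrict_of_subset (cellIco_subset_typeSpace hn j)
      (ae_partialDeriv_mem_Icc hu k)
  refine ⟨fun j => ?_, fun j k => ?_, fun i j => hu.average_incentive hn i j, fun k => ?_⟩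
  · rw [setAverage_cellIco hn]
    exact mul_nonneg (by positivity) (setIntegral_nonneg (measurableSet_cellIco j) fun x hx =>
      hu.nonneg x (cellIco_subset_typeSpace hn j hx))
  · exact (convex_Icc (0 : ℝ) 1).set_average_mem isClosed_Icc (volume_cellIco_ne_zero hn j)
      (volume_cellIco_ne_top j) (hmem j k) (hint j k continuous_id)
  · rw [majorizedBy_discreteLaw_iff hn hρ h0 hmass]
    intro φ hφ hφm hφi
    have hc := continuous_of_convexOn_univ hφ
    refine le_trans ?_
      ((majorizedBy_map_partialDeriv_iff hρ h0 hu k _).1 (hw.majorized k) φ hφ hφm hφi)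
    have hρφ := IntegrableOn.density_mul hρ (integrableOn_comp_partialDeriv hu k hc)
    rw [restWeight_mul_eq hn hρ hmass, ← Finset.sum_add_distrib,
      ← sum_setIntegral_cellIco hn hρφ]
    refine Finset.sum_le_sum fun j _ => ?_
    -- Jensen's inequality on one cell.
    have hJ : weight ρ j * φ (⨍ x in cellIco j, partialDeriv w k x) ≤
        ∫ x in cellIco j, cellMin ρ j * φ (partialDeriv w k x) := by
      rw [← weight_mul_setAverage hn]
      refine mul_le_mul_of_nonneg_left ?_ (weight_nonneg hn hρ h0 j)
      exact hφ.map_set_average_le hc.continuousOn isClosed_univ (volume_cellIco_ne_zero hn j)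
        (volume_cellIco_ne_top j) (by simp) (hint j k continuous_id) (hint j k hc)
    have hi1 : IntegrableOn (fun x => (ρ x - cellMin ρ j) * φ 0) (cellIco j) :=
      Integrable.mul_const ((((hρ.integrableOn_compact isCompact_typeSpace).mono_set
        (cellIco_subset_typeSpace hn j))).sub (integrableOn_const (volume_cellIco_ne_top j))) _
    have hi2 : IntegrableOn (fun x => cellMin ρ j * φ (partialDeriv w k x)) (cellIco j) :=
      (hint j k hc).const_mul _
    refine (add_le_add le_rfl hJ).trans ?_
    rw [← integral_add hi1 hi2]
    refine integral_mono_ae (hi1.add hi2) (hρφ.mono_set (cellIco_subset_typeSpace hn j)) ?_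
    filter_upwards [hmem j k, ae_restrict_mem (measurableSet_cellIco j)] with x hx hxj
    have h1 := cellMin_le hn hρ (cellIco_subset_cell j hxj)
    -- On the excess mass `ρ - cellMin ρ j ≥ 0`, monotonicity gives `φ 0 ≤ φ (∂w)` because the
    -- derivative is non-negative.
    have h2 := mul_le_mul_of_nonneg_left (hφm hx.1) (sub_nonneg.2 h1)
    linarith

/-- The objective is linear in `(u, p)`, so the averages unfold into cell integrals of `w` and `∇w`
themselves; only the centers and the cell minima of `ρ` vary in the limit. -/
theorem tendsto_discreteValue_average {m : ℕ → ℕ} (hm : Tendsto m atTop atTop)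
    (hm1 : ∀ k, 1 ≤ m k) (hρ : ContinuousOn ρ (typeSpace I)) {C : ℝ}
    (hC : ∀ x ∈ typeSpace I, 0 ≤ ρ x ∧ ρ x ≤ C) (hw : IsLipUtility w) :
    Tendsto (fun k => discreteValue ρ (fun j : Fin I → Fin (m k) => ⨍ x in cellIco j, w x)
      (fun j i => ⨍ x in cellIco j, partialDeriv w i x)) atTop
      (𝓝 (revenuePerBidder ρ w)) := by
  have hpi : ∀ k (j : Fin I → Fin (m k)) i,
      IntegrableOn (fun x => center j i * partialDeriv w i x) (cellIco j) := fun k j i =>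
    ((integrableOn_comp_partialDeriv hw i continuous_id).mono_set
      (cellIco_subset_typeSpace (hm1 k) j)).const_mul _
  have e : ∀ k, discreteValue ρ (fun j : Fin I → Fin (m k) => ⨍ x in cellIco j, w x)
      (fun j i => ⨍ x in cellIco j, partialDeriv w i x) =
      ∑ j : Fin I → Fin (m k), ∫ x in cellIco j,
        cellMin ρ j * ((∑ i, center j i * partialDeriv w i x) - w x) := fun k => by
    refine Finset.sum_congr rfl fun j _ => ?_
    rw [← weight_mul_setAverage (hm1 k)]
    congr 1
    simp_rw [setAverage_cellIco (hm1 k)]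
    rw [integral_sub (integrable_finsetSum _ fun i _ => hpi k j i)
      (hw.integrableOn.mono_set (cellIco_subset_typeSpace (hm1 k) j)),
      integral_finsetSum _ fun i _ => hpi k j i, mul_sub, Finset.mul_sum]
    congr 1
    refine Finset.sum_congr rfl fun i _ => ?_
    rw [integral_const_mul]
    ring
  simp_rw [e]
  rw [revenuePerBidder_eq hρ fun x hx => (hC x hx).1]
  refine tendsto_sum_setIntegral_cellIco hm1
    (fun k j x => cellMin ρ j * ((∑ i, center j i * partialDeriv w i x) - w x)) _ (C * I)
    (fun k j => ?_) (fun k j => ?_) (Eventually.of_forall fun x J hJ => ?_)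
  · refine AEStronglyMeasurable.const_mul (AEStronglyMeasurable.sub ?_
      (hw.continuousOn.aestronglyMeasurable measurableSet_typeSpace)) _
    exact (Finset.measurable_fun_sum _ fun i _ =>
      (measurable_partialDeriv w i).const_mul _).aestronglyMeasurable
  · filter_upwards [ae_all_iff.2 fun i => ae_partialDeriv_mem_Icc hw i,
      ae_restrict_mem measurableSet_typeSpace] with x hx hxX
    rw [abs_mul]
    have h := abs_cellMin_le (hm1 k) hρ hC j
    exact mul_le_mul h (sum_mul_sub_mem_Icc
      (cell_subset_typeSpace (hm1 k) _ (center_mem_cell j)) hx ⟨hw.nonneg x hxX, hw.le_card hxX⟩)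
      (abs_nonneg _) ((abs_nonneg _).trans h)
  · have hcen := tendsto_pi_nhds.1 (tendsto_of_mem_cell hm hJ fun k => center_mem_cell (J k))
    exact (tendsto_cellMin hm hm1 hρ hJ).mul
      ((tendsto_finsetSum _ fun i _ => (hcen i).mul_const _).sub_const _)

end average

/-- A limit of extensions of optimal discrete solutions is feasible, has maximal revenue, and the
discrete optimal values converge to its revenue. -/
theorem isGreatest_of_tendsto_extension {m : ℕ → ℕ} (hm : Tendsto m atTop atTop)
    (hm1 : ∀ k, 1 ≤ m k) (hρ : ContinuousOn ρ (typeSpace I)) {C : ℝ}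
    (hC : ∀ x ∈ typeSpace I, 0 ≤ ρ x ∧ ρ x ≤ C) (hmass : ∫ x in typeSpace I, ρ x = 1)
    {u : ∀ k, (Fin I → Fin (m k)) → ℝ} {p : ∀ k, (Fin I → Fin (m k)) → Fin I → ℝ}
    (hopt : ∀ k, IsDiscreteOptimal B ρ (u k) (p k))
    (hlip : ∀ k, IsLipUtility (extension (u k) (p k))) {v : (Fin I → ℝ) → ℝ}
    (hv : ∀ x ∈ typeSpace I, Tendsto (fun k => extension (u k) (p k) x) atTop (𝓝 (v x))) :
    IsFeasible B ρ v ∧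
      IsGreatest (revenuePerBidder ρ '' {v | IsFeasible B ρ v}) (revenuePerBidder ρ v) ∧
      Tendsto (fun k => discreteValue ρ (u k) (p k)) atTop (𝓝 (revenuePerBidder ρ v)) := by
  obtain ⟨hf, ht⟩ := isFeasible_and_tendsto_discreteValue hm hm1 hρ hC hmass
    (fun k => (hopt k).feasible) hlip hv
  refine ⟨hf, ⟨⟨v, hf, rfl⟩, ?_⟩, ht⟩
  rintro _ ⟨w, hw, rfl⟩
  have hw' : IsFeasible B ρ w := hw
  exact le_of_tendsto_of_tendsto'
    (tendsto_discreteValue_average hm hm1 hρ hC hw'.isLipUtility) ht fun k =>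
      (hopt k).optimal _ _
        (hw'.isDiscreteFeasible_average (hm1 k) hρ (fun x hx => (hC x hx).1) hmass)

end RochetChone

/-! ### Convergence of the discretized programs -/

theorem theorem4 {I B : ℕ} (hI : 1 ≤ I) (hB : 1 ≤ B) (ρ : (Fin I → ℝ) → ℝ)
    (hρ : ContDiffOn ℝ 1 ρ (typeSpace I))
    (hbound : ∃ c C : ℝ, 0 < c ∧ c < C ∧ ∀ x ∈ typeSpace I, c ≤ ρ x ∧ ρ x ≤ C)
    (hmass : ∫ x in typeSpace I, ρ x = 1)
    (u : (n : ℕ) → (Fin I → Fin n) → ℝ)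
    (p : (n : ℕ) → (Fin I → Fin n) → Fin I → ℝ)
    (hopt : ∀ n, 1 ≤ n → IsDiscreteOptimal B ρ (u n) (p n)) :
    (∃ (m : ℕ → ℕ) (v : (Fin I → ℝ) → ℝ), StrictMono m ∧
      TendstoUniformlyOn (fun k => extension (u (m k)) (p (m k))) v atTop (typeSpace I)) ∧
    (∀ (m : ℕ → ℕ) (v : (Fin I → ℝ) → ℝ), StrictMono m →
      TendstoUniformlyOn (fun k => extension (u (m k)) (p (m k))) v atTop (typeSpace I) →
      IsOptimal B ρ v) ∧
    ∃ V : ℝ, IsGreatest (revenuePerBidder ρ '' {v | IsFeasible B ρ v}) V ∧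
      Tendsto (fun n => discreteValue ρ (u n) (p n)) atTop (𝓝 V) := by
  obtain ⟨c, C, hc, -, hcC⟩ := hbound
  have hρc := hρ.continuousOn
  have hC : ∀ x ∈ typeSpace I, 0 ≤ ρ x ∧ ρ x ≤ C := fun x hx =>
    ⟨hc.le.trans (hcC x hx).1, (hcC x hx).2⟩
  have hlip : ∀ n, 1 ≤ n → IsLipUtility (extension (u n) (p n)) := fun n hn =>
    isLipUtility_extension hn (hopt n hn).feasible.fs ((hopt n hn).extension_zero hn
      (weight_pos hn hρc fun x hx => hc.trans_le (hcC x hx).1))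
  have hcompact : ∀ m : ℕ → ℕ, (∀ k, 1 ≤ m k) →
      ∃ (s : ℕ → ℕ) (v : (Fin I → ℝ) → ℝ), StrictMono s ∧ TendstoUniformlyOn
        (fun k => extension (u (m (s k))) (p (m (s k)))) v atTop (typeSpace I) := fun m hm1 =>
    exists_subseq_tendstoUniformlyOn (f := fun k => extension (u (m k)) (p (m k)))
      fun k => hlip _ (hm1 k)
  have hlimit : ∀ m : ℕ → ℕ, Tendsto m atTop atTop → (∀ k, 1 ≤ m k) →
      ∀ v : (Fin I → ℝ) → ℝ, (∀ x ∈ typeSpace I,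
        Tendsto (fun k => extension (u (m k)) (p (m k)) x) atTop (𝓝 (v x))) →
      IsFeasible B ρ v ∧
      IsGreatest (revenuePerBidder ρ '' {v | IsFeasible B ρ v}) (revenuePerBidder ρ v) ∧
      Tendsto (fun k => discreteValue ρ (u (m k)) (p (m k))) atTop
        (𝓝 (revenuePerBidder ρ v)) := fun m hm hm1 v hv =>
    isGreatest_of_tendsto_extension hm hm1 hρc hC hmass (fun k => hopt _ (hm1 k))
      (fun k => hlip _ (hm1 k)) hv
  -- Indices are shifted by one because optimality is assumed only for `n ≥ 1`.
  obtain ⟨s, v, hs, hv⟩ := hcompact (fun k => k + 1) fun k => Nat.le_add_left 1 k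
  refine ⟨⟨fun k => s k + 1, v, fun a b hab => Nat.add_lt_add_right (hs hab) 1, hv⟩, ?_, ?_⟩
  · intro m v hm hv
    -- A strictly increasing `m` can vanish only at `k = 0`, so the first term is dropped.
    obtain ⟨hf, hg, -⟩ := hlimit (fun k => m (k + 1))
      (hm.tendsto_atTop.comp (tendsto_add_atTop_nat 1))
      (fun k => (Nat.le_add_left 1 k).trans (hm.id_le _)) v
      fun x hx => (hv.tendsto_at hx).comp (tendsto_add_atTop_nat 1)
    exact ⟨hf, fun w hw => mul_le_mul_of_nonneg_left (hg.2 ⟨w, hw, rfl⟩) (Nat.cast_nonneg B)⟩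
  · obtain ⟨-, hg, -⟩ := hlimit (fun k => s k + 1)
      ((tendsto_add_atTop_nat 1).comp hs.tendsto_atTop) (fun k => Nat.le_add_left 1 _) v
      fun x hx => hv.tendsto_at hx
    refine ⟨revenuePerBidder ρ v, hg, (tendsto_add_atTop_iff_nat 1).1 ?_⟩
    -- Every subsequence has a further one along which the values tend to a greatest revenue, and
    -- the greatest element is unique.
    refine tendsto_of_subseq_tendsto fun ns hns => ?_
    obtain ⟨s', v', hs', hv'⟩ := hcompact (fun k => ns k + 1) fun k => Nat.le_add_left 1 _
    obtain ⟨-, hg', ht⟩ := hlimit (fun k => ns (s' k) + 1)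
      ((tendsto_add_atTop_nat 1).comp (hns.comp hs'.tendsto_atTop))
      (fun k => Nat.le_add_left 1 _) v' fun x hx => hv'.tendsto_at hx
    refine ⟨s', ?_⟩
    rw [hg.unique hg']
    exact ht
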